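/- **Theorem 5.1.** Let $M$ be a smooth manifold (Hausdorff, second countable, finite-dimensional, without boundary) and let $X$ be a smooth vector field on $M$. Write $\mathrm{supp}(X)$ for the closure of $\{x\in M : X_x\neq 0\}$ and $\mathrm{Fl}^t_X$ for the (maximal, local) flow of $X$. Suppose that 1. $h\in C^\infty(M)$ is a first integral of $X$, i.e. $\mathrm{d}h(X)=0$, that is regular on $\mathrm{supp}(X)$, i.e. $\mathrm{d}_xh\neq 0$ for every $x\in\mathrm{supp}(X)$; and 2. $g$ is a smooth Riemannian metric on $M$ that is transversally invariant for $X$: if $\eta$ denotes the metric dual to $g$ on covectors, then for every $m\in M$ with orbit $O$ and every $t$ for which $m'=\mathrm{Fl}^t_X(m)$ is defined, the map $(\mathrm{d}_m\mathrm{Fl}^t_X)^*:(T_{m'}O)^\circ\to (T_mO)^\circ$ is isometric with respect to $\eta$, where $(T_pO)^\circ\subseteq T_p^*M$ is the annihilator of $T_pO=\mathbb{R}X_p$. Then $X$ is hamiltonizable on $M$: there are a Poisson structure $\pi$ on $M$ (a smooth bivector field whose Schouten–Nijenhuis bracket $[\pi,\pi]$ vanishes) and a function $f\in C^\infty(M)$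 such that $\pi^\sharp\mathrm{d}f=X$, where $\pi^\sharp\alpha=\pi(\alpha,\cdot)$. More precisely, one can take $f=h$ and $\pi=Y\wedge X$, where $Y$ is a smooth vector field on $M$ which on $\mathrm{supp}(X)$ equals the normalized gradient of $h$, $$Y=\frac{\eta^\sharp\mathrm{d}h}{\eta(\mathrm{d}h,\mathrm{d}h)}\quad\text{on }\mathrm{supp}(X).$$ (Here $(Y\wedge X)(\alpha,\beta)=\alpha(Y)\beta(X)-\alpha(X)\beta(Y)$.) -/

import Mathlib

open Set Topology
open scoped Manifold ContDiff

set_option maxSynthPendingDepth 3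

noncomputable section

namespace Hamiltonization

/-! ### Linear algebra in one tangent space -/

section Linear

/-- Bivectors of a finite-dimensional space `V`, as bilinear forms on the dual space `V*`
(the elements of `⋀² V` are the alternating ones, see `IsPoisson.alternating` below). -/
abbrev Bivec (V : Type*) [AddCommGroup V] [Module ℝ V] [TopologicalSpace V] : Type _ :=
  (V →L[ℝ] ℝ) →L[ℝ] (V →L[ℝ] ℝ) →L[ℝ] ℝ

variable {V : Type*} [AddCommGroup V] [Module ℝ V] [TopologicalSpace V]

/-- The bilinear form underlying a scalar product on `V`. -/
def toBilin (b : V →L[ℝ] V →L[ℝ] ℝ) : LinearMap.BilinForm ℝ V :=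
  LinearMap.mk₂ ℝ (fun v w => b v w) (by simp) (by simp) (by simp) (by simp)

lemma nondegenerate_toBilin (b : V →L[ℝ] V →L[ℝ] ℝ) (hb : ∀ v, v ≠ 0 → 0 < b v v) :
    (toBilin b).Nondegenerate := by
  constructor
  · intro v hv
    by_contra hne
    exact (hb v hne).ne' (hv v)
  · intro v hv
    by_contra hne
    exact (hb v hne).ne' (hv v)

/-- The Riesz representative of `α` for a positive definite form `b`: the vector `v` with
`b v w = α w` for all `w`. -/
def riesz [FiniteDimensional ℝ V] (b : V →L[ℝ] V →L[ℝ] ℝ) (hb : ∀ v, v ≠ 0 → 0 < b v v)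
    (α : V →L[ℝ] ℝ) : V :=
  ((toBilin b).toDual (nondegenerate_toBilin b hb)).symm α.toLinearMap

lemma apply_riesz [FiniteDimensional ℝ V] (b : V →L[ℝ] V →L[ℝ] ℝ)
    (hb : ∀ v, v ≠ 0 → 0 < b v v) (α : V →L[ℝ] ℝ) (w : V) : b (riesz b hb α) w = α w :=
  LinearMap.BilinForm.apply_toDual_symm_apply (hB := nondegenerate_toBilin b hb) α.toLinearMap w

variable [ContinuousSMul ℝ V]

/-- The vector `v`, as the linear form `α ↦ α v` on the dual space. -/
def evalAt (v : V) : (V →L[ℝ] ℝ) →L[ℝ] ℝ where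
  toFun α := α v
  map_add' _ _ := rfl
  map_smul' _ _ := rfl
  cont := continuous_eval_const v

@[simp] lemma evalAt_apply (v : V) (α : V →L[ℝ] ℝ) : evalAt v α = α v := rfl

/-- The decomposable bivector `v ∧ w`, that is `(α, β) ↦ α v * β w - α w * β v`. -/
def wedge (v w : V) : Bivec V :=
  (evalAt v).smulRight (evalAt w) - (evalAt w).smulRight (evalAt v)

@[simp] lemma wedge_apply (v w : V) (α β : V →L[ℝ] ℝ) :
    wedge v w α β = α v * β w - α w * β v := by
  simp [wedge]

variable [IsTopologicalAddGroup V] [T2Space V] [FiniteDimensional ℝ V]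

/-- The contraction `π^♯ α = i_α π = π(α, ·)`, regarded as a vector by `V = V**`. -/
def sharp (π : Bivec V) (α : V →L[ℝ] ℝ) : V :=
  (Module.evalEquiv ℝ V).symm
    ((π α).toLinearMap ∘ₗ (LinearMap.toContinuousLinearMap : (V →ₗ[ℝ] ℝ) ≃ₗ[ℝ] _).toLinearMap)

lemma apply_sharp (π : Bivec V) (α β : V →L[ℝ] ℝ) : β (sharp π α) = π α β := by
  have h := Module.apply_evalEquiv_symm_apply (R := ℝ) (M := V) β.toLinearMap
    ((π α).toLinearMap ∘ₗ (LinearMap.toContinuousLinearMap : (V →ₗ[ℝ] ℝ) ≃ₗ[ℝ] _).toLinearMap)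
  exact h

end Linear

/-! ### Manifolds (Hausdorff and so on are hypotheses of the theorem) -/

variable {E : Type*} [NormedAddCommGroup E] [NormedSpace ℝ E]
  {M : Type*} [TopologicalSpace M] [ChartedSpace E M]

instance instT2SpaceTangent (x : M) : T2Space (TangentSpace 𝓘(ℝ, E) x) :=
  inferInstanceAs (T2Space E)

instance instFiniteDimensionalTangent [FiniteDimensional ℝ E] (x : M) :
    FiniteDimensional ℝ (TangentSpace 𝓘(ℝ, E) x) :=
  inferInstanceAs (FiniteDimensional ℝ E)

/-- `X` is a smooth vector field on `M`. -/
def IsSmoothVectorField [IsManifold 𝓘(ℝ, E) ∞ M] (X : ∀ x : M, TangentSpace 𝓘(ℝ, E) x) : Prop :=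
  ContMDiff 𝓘(ℝ, E) 𝓘(ℝ, E).tangent ∞ (fun x => (⟨x, X x⟩ : TangentBundle 𝓘(ℝ, E) M))

/-- The support of a vector field: the closure of the set where it does not vanish. -/
def supp (X : ∀ x : M, TangentSpace 𝓘(ℝ, E) x) : Set M := closure {x | X x ≠ 0}

variable (E) in
/-- The differential `dh` of a function, a covector at each point. -/
def differential (h : M → ℝ) (x : M) : TangentSpace 𝓘(ℝ, E) x →L[ℝ] ℝ :=
  mfderiv 𝓘(ℝ, E) 𝓘(ℝ) h x

/-- `h` is a (smooth) first integral of `X`: `dh(X) = 0`. -/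
def IsFirstIntegral (X : ∀ x : M, TangentSpace 𝓘(ℝ, E) x) (h : M → ℝ) : Prop :=
  ContMDiff 𝓘(ℝ, E) 𝓘(ℝ) ∞ h ∧ ∀ x, differential E h x (X x) = 0

variable (E) in
/-- `h` is regular on `S`: it has no critical point in `S`. -/
def IsRegularOn (h : M → ℝ) (S : Set M) : Prop := ∀ x ∈ S, differential E h x ≠ 0

/-! ### Poisson structures -/

/-- The covector `α` at `x`, extended with constant coefficients in the chart `φ` at `x`. If
`φ = (x¹, …, xᵐ)` and `α = ∑ aᵢ dxⁱ` at `x`, this is the 1-form `∑ aᵢ dxⁱ` on the chart domain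
(recall that `TangentSpace 𝓘(ℝ, E) x` is `E` through the chart at `x`). -/
def chartExtend (x : M) (α : TangentSpace 𝓘(ℝ, E) x →L[ℝ] ℝ) (p : M) :
    TangentSpace 𝓘(ℝ, E) p →L[ℝ] ℝ :=
  (show E →L[ℝ] ℝ from α).comp
    (show TangentSpace 𝓘(ℝ, E) p →L[ℝ] E from mfderiv 𝓘(ℝ, E) 𝓘(ℝ, E) (extChartAt 𝓘(ℝ, E) x) p)

/-- The extension of `α` really has the value `α` at `x`. -/
lemma chartExtend_self [IsManifold 𝓘(ℝ, E) ∞ M] (x : M) (α : TangentSpace 𝓘(ℝ, E) x →L[ℝ] ℝ) :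
    chartExtend x α x = α := by
  ext v
  have h := mfderiv_extChartAt_self (I := 𝓘(ℝ, E)) (x := x)
  simp only [chartExtend, h]
  rfl

/-- One half of the Schouten-Nijenhuis bracket of bivector fields, in the coordinates `φ` at `x`:
`∑ (π^{il} ∂_l σ^{jk} + π^{jl} ∂_l σ^{ki} + π^{kl} ∂_l σ^{ij}) αᵢ βⱼ γₖ` (sum over all indices). -/
def schoutenHalf [FiniteDimensional ℝ E] (π σ : ∀ x : M, Bivec (TangentSpace 𝓘(ℝ, E) x)) (x : M)
    (α β γ : TangentSpace 𝓘(ℝ, E) x →L[ℝ] ℝ) : ℝ :=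
  differential E (fun p => σ p (chartExtend x β p) (chartExtend x γ p)) x (sharp (π x) α) +
  differential E (fun p => σ p (chartExtend x γ p) (chartExtend x α p)) x (sharp (π x) β) +
  differential E (fun p => σ p (chartExtend x α p) (chartExtend x β p)) x (sharp (π x) γ)

/-- The Schouten-Nijenhuis bracket `[π, σ]` of two bivector fields, as a trilinear form on
covectors, by its coordinate formula at each point. -/
def schouten [FiniteDimensional ℝ E] (π σ : ∀ x : M, Bivec (TangentSpace 𝓘(ℝ, E) x)) (x : M)
    (α β γ : TangentSpace 𝓘(ℝ, E) x →L[ℝ] ℝ) : ℝ :=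
  schoutenHalf π σ x α β γ + schoutenHalf σ π x α β γ

/-- `π` is a Poisson structure on `M`: a smooth bivector field with `[π, π] = 0`. -/
structure IsPoisson [FiniteDimensional ℝ E] [IsManifold 𝓘(ℝ, E) ∞ M]
    (π : ∀ x : M, Bivec (TangentSpace 𝓘(ℝ, E) x)) : Prop where
  alternating : ∀ x α, π x α α = 0
  smooth : ContMDiff 𝓘(ℝ, E) (𝓘(ℝ, E).prod 𝓘(ℝ, (E →L[ℝ] ℝ) →L[ℝ] (E →L[ℝ] ℝ) →L[ℝ] ℝ)) ∞
    (fun x => Bundle.TotalSpace.mk' ((E →L[ℝ] ℝ) →L[ℝ] (E →L[ℝ] ℝ) →L[ℝ] ℝ)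
      (E := fun x : M => Bivec (TangentSpace 𝓘(ℝ, E) x)) x (π x))
  jacobi : ∀ x α β γ, schouten π π x α β γ = 0

/-- `X = π^♯ dh`: the vector field `X` is Hamiltonian for `π`, with Hamiltonian function `h`. -/
def IsHamiltonianFor [FiniteDimensional ℝ E] (π : ∀ x : M, Bivec (TangentSpace 𝓘(ℝ, E) x))
    (h : M → ℝ) (X : ∀ x : M, TangentSpace 𝓘(ℝ, E) x) : Prop :=
  ∀ x, sharp (π x) (differential E h x) = X x

/-- `X` is hamiltonizable: it is a Hamiltonian vector field for some Poisson structure on `M`. -/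
def IsHamiltonizable [FiniteDimensional ℝ E] [IsManifold 𝓘(ℝ, E) ∞ M]
    (X : ∀ x : M, TangentSpace 𝓘(ℝ, E) x) : Prop :=
  ∃ (π : ∀ x : M, Bivec (TangentSpace 𝓘(ℝ, E) x)) (h : M → ℝ),
    IsPoisson π ∧ ContMDiff 𝓘(ℝ, E) 𝓘(ℝ) ∞ h ∧ IsHamiltonianFor π h X

/-! ### The flow of a vector field -/

/-- `γ` restricts to an integral curve of `X` on an open interval containing `0` and `t`,
and starts at `m`. -/
def IsFlowLine (X : ∀ x : M, TangentSpace 𝓘(ℝ, E) x) (t : ℝ) (m : M) (γ : ℝ → M) : Prop :=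
  γ 0 = m ∧ ∃ a b : ℝ, 0 ∈ Ioo a b ∧ t ∈ Ioo a b ∧ IsMIntegralCurveOn γ X (Ioo a b)

/-- The (maximal) flow of `X` is defined at time `t` and the point `m`. -/
def FlowDefined (X : ∀ x : M, TangentSpace 𝓘(ℝ, E) x) (t : ℝ) (m : M) : Prop :=
  ∃ γ : ℝ → M, IsFlowLine X t m γ

open Classical in
/-- The (maximal) flow `Fl^t_X` of `X`; where it is not defined, the value is irrelevant. -/
def flow (X : ∀ x : M, TangentSpace 𝓘(ℝ, E) x) (t : ℝ) (m : M) : M :=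
  if H : FlowDefined X t m then H.choose t else m

/-- On a Hausdorff manifold, the flow follows every integral curve of a smooth vector field. -/
lemma flow_eq [CompleteSpace E] [IsManifold 𝓘(ℝ, E) ∞ M] [T2Space M]
    {X : ∀ x : M, TangentSpace 𝓘(ℝ, E) x} (hX : IsSmoothVectorField X) {t : ℝ} {m : M}
    {γ : ℝ → M} (hγ : IsFlowLine X t m γ) : flow X t m = γ t := by
  have H : FlowDefined X t m := ⟨γ, hγ⟩
  obtain ⟨h0, a, b, ha0, hat, hc⟩ := hγ
  obtain ⟨h0', a', b', ha0', hat', hc'⟩ := H.choose_spec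
  have hsub := isMIntegralCurveOn_Ioo_eqOn_of_contMDiff_boundaryless (I := 𝓘(ℝ, E))
    (a := max a a') (b := min b b') (t₀ := 0)
    ⟨max_lt ha0.1 ha0'.1, lt_min ha0.2 ha0'.2⟩ (hX.of_le (by norm_cast))
    (hc'.mono (Ioo_subset_Ioo (le_max_right _ _) (min_le_right _ _)))
    (hc.mono (Ioo_subset_Ioo (le_max_left _ _) (min_le_left _ _))) (h0'.trans h0.symm)
  rw [flow, dif_pos H]
  exact hsub ⟨max_lt hat.1 hat'.1, lt_min hat.2 hat'.2⟩

/-! ### Riemannian metrics -/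

variable (E M) in
/-- Smooth Riemannian metrics on `M`. -/
abbrev RiemMetric [IsManifold 𝓘(ℝ, E) ∞ M] :=
  Bundle.ContMDiffRiemannianMetric 𝓘(ℝ, E) ∞ E (fun x : M => TangentSpace 𝓘(ℝ, E) x)

/-- `η^♯ α`, the vector at `x` dual to the covector `α` with respect to `g`. -/
def metricSharp [FiniteDimensional ℝ E] [IsManifold 𝓘(ℝ, E) ∞ M] (g : RiemMetric E M) (x : M)
    (α : TangentSpace 𝓘(ℝ, E) x →L[ℝ] ℝ) : TangentSpace 𝓘(ℝ, E) x :=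
  riesz (g.inner x) (g.pos x) α

/-- The dual metric `η` of `g`, a scalar product on covectors. -/
def dualMetric [FiniteDimensional ℝ E] [IsManifold 𝓘(ℝ, E) ∞ M] (g : RiemMetric E M) (x : M)
    (α β : TangentSpace 𝓘(ℝ, E) x →L[ℝ] ℝ) : ℝ :=
  g.inner x (metricSharp g x α) (metricSharp g x β)

/-- The metric `g` is transversally invariant for `X`: wherever the flow is defined,
`(d_m Fl^t)^*` is isometric for the dual metric from the annihilator of the tangent space of the
orbit `O` at `Fl^t(m)` to its annihilator at `m`. The tangent space of `O` at a point is
spanned by the value of `X` there. -/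
def IsTransversallyInvariant [FiniteDimensional ℝ E] [IsManifold 𝓘(ℝ, E) ∞ M] (g : RiemMetric E M)
    (X : ∀ x : M, TangentSpace 𝓘(ℝ, E) x) : Prop :=
  ∀ (t : ℝ) (m : M), FlowDefined X t m →
    ∀ α β : TangentSpace 𝓘(ℝ, E) (flow X t m) →L[ℝ] ℝ,
      α (X (flow X t m)) = 0 → β (X (flow X t m)) = 0 →
        dualMetric g m (α.comp (mfderiv 𝓘(ℝ, E) 𝓘(ℝ, E) (flow X t) m))
          (β.comp (mfderiv 𝓘(ℝ, E) 𝓘(ℝ, E) (flow X t) m)) =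
        dualMetric g (flow X t m) α β

/-- The normalized gradient `η^♯ dh / η(dh, dh)` of `h` (relevant only where `dh ≠ 0`). -/
def normalizedGradient [FiniteDimensional ℝ E] [IsManifold 𝓘(ℝ, E) ∞ M] (g : RiemMetric E M)
    (h : M → ℝ) (x : M) : TangentSpace 𝓘(ℝ, E) x :=
  (dualMetric g x (differential E h x) (differential E h x))⁻¹ •
    metricSharp g x (differential E h x)

end Hamiltonization

end

noncomputable section

namespace Hamiltonization

open Filter

/-! For `π = Y ∧ X` one has `π^♯ dh = dh(Y) X - dh(X) Y = dh(Y) X`. This equals `X` as soon as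
`dh(Y) = 1` wherever `X ≠ 0`, and the normalized gradient `N` of `h` satisfies `dh(N) = 1` wherever
`dh ≠ 0`. Up to a constant factor `[π, π]` is `Y ∧ X ∧ [Y, X]`, so the Jacobi identity reduces to
`[N, X]` being a multiple of `X` where `X ≠ 0` (`jacobi_of_bracket_tangent`).

Here the metric enters. The flow preserves `h`, so it pulls `dh` back to `dh`. Since `dh`
annihilates `X`, transversal invariance applied to the pairs `(dh, dh)` and `(α, dh)` gives `α(dFl^t
N) = α(N ∘ Fl^t)` for every `α` annihilating `X` (`IsTransversallyInvariant.apply_mfderiv_flow`).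
Differentiating at `t = 0` shows that the bracket is parallel to `X`
(`IsTransversallyInvariant.bracket_tangent`).

This differentiation needs `dFl^t = 1 + t DX + o(t)` in a chart, but only at one base point and for
`t → 0⁺`. Grönwall estimates provide it (`eventually_differentiableAt_flow`,
`tendsto_slope_fderiv_flow`), and `flow_first_order` carries it to the manifold.

Finally, `N` is smooth only where `dh ≠ 0`, an open set containing `supp X`; a partition of unity
produces a global `Y` equal to `N` on `supp X` (`exists_smooth_eq_normalizedGradient`). -/

/-! ### Differentiability of local flows in the initial value -/

/-- Local flow of a `C¹` vector field on a Banach space, jointly continuous at the base point. -/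
lemma exists_local_flow {E : Type*} [NormedAddCommGroup E] [NormedSpace ℝ E] [CompleteSpace E]
    {V : E → E} {z₀ : E} (hV : ContDiffAt ℝ 1 V z₀) :
    ∃ F : E × ℝ → E, (∀ᶠ x in 𝓝 z₀, F (x, 0) = x) ∧ Tendsto F (𝓝 (z₀, 0)) (𝓝 z₀) ∧
      ∀ᶠ p in 𝓝 (z₀, (0 : ℝ)), HasDerivAt (fun t => F (p.1, t)) (V (F p)) p.2 := by
  obtain ⟨ε, hε, a, r, L, K, hr, hpl⟩ := IsPicardLindelof.of_contDiffAt_one hV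
  obtain ⟨F, hF, hc⟩ :=
    (hpl 0).exists_forall_mem_closedBall_eq_hasDerivWithinAt_continuousOn
  have hball : Metric.closedBall z₀ (r : ℝ) ∈ 𝓝 z₀ := Metric.closedBall_mem_nhds _ hr
  have hI : Icc (0 - ε) (0 + ε) ∈ 𝓝 (0 : ℝ) := Icc_mem_nhds (by simpa) (by simpa)
  have hF0 : F (z₀, 0) = z₀ := (hF z₀ (mem_of_mem_nhds hball)).1
  refine ⟨F, ?_, ?_, ?_⟩
  · filter_upwards [hball] with x hx using (hF x hx).1
  · have := (hc (z₀, 0) ⟨mem_of_mem_nhds hball, mem_of_mem_nhds hI⟩).continuousAt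
      (prod_mem_nhds hball hI)
    simpa [ContinuousAt, hF0] using this
  · filter_upwards [prod_mem_nhds hball (Ioo_mem_nhds (a := 0 - ε) (b := 0 + ε) (by simpa)
      (by simpa))] with p hp
    exact ((hF p.1 hp.1).2 p.2 (Ioo_subset_Icc_self hp.2)).hasDerivAt (Icc_mem_nhds hp.2.1 hp.2.2)

/-- If two solutions of `x' = V x` stay in a set where `V` is approximated by the linear map `D`
up to `ε`, then their difference evolves like `1 + t D`, up to a small error. -/
lemma norm_sub_sub_le_of_approximatesLinearOn {E : Type*} [NormedAddCommGroup E]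
    [NormedSpace ℝ E] {V : E → E} {D : E →L[ℝ] E} {s : Set E} {ε : NNReal}
    (hV : ApproximatesLinearOn V D s ε) {x y : ℝ → E} {T : ℝ}
    (hx : ∀ t ∈ Icc 0 T, HasDerivAt x (V (x t)) t) (hy : ∀ t ∈ Icc 0 T, HasDerivAt y (V (y t)) t)
    (hxs : ∀ t ∈ Icc 0 T, x t ∈ s) (hys : ∀ t ∈ Icc 0 T, y t ∈ s) (hT : 0 ≤ T) :
    ‖x T - y T - (x 0 - y 0) - T • D (x 0 - y 0)‖ ≤
      (ε + ‖D‖ * (‖D‖ + ε) * T) * Real.exp ((‖D‖ + ε) * T) * ‖x 0 - y 0‖ * T := by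
  set K : ℝ := ‖D‖ + ε with hK
  have hK0 : 0 ≤ K := by positivity
  set d : ℝ → E := fun t => x t - y t with hd
  have hd' : ∀ t ∈ Icc 0 T, HasDerivAt d (V (x t) - V (y t)) t := fun t ht =>
    (hx t ht).sub (hy t ht)
  have happ : ∀ t ∈ Icc 0 T, ‖V (x t) - V (y t) - D (d t)‖ ≤ ε * ‖d t‖ := fun t ht =>
    hV (x t) (hxs t ht) (y t) (hys t ht)
  have hlip : ∀ t ∈ Icc 0 T, ‖V (x t) - V (y t)‖ ≤ K * ‖d t‖ := fun t ht => by
    calc ‖V (x t) - V (y t)‖ = ‖D (d t) + (V (x t) - V (y t) - D (d t))‖ := by congr 1; abel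
      _ ≤ ‖D (d t)‖ + ‖V (x t) - V (y t) - D (d t)‖ := norm_add_le _ _
      _ ≤ ‖D‖ * ‖d t‖ + ε * ‖d t‖ := add_le_add (D.le_opNorm _) (happ t ht)
      _ = K * ‖d t‖ := by rw [hK]; ring
  have hgr : ∀ t ∈ Icc 0 T, ‖d t‖ ≤ ‖d 0‖ * Real.exp (K * T) := fun t ht => by
    have := norm_le_gronwallBound_of_norm_deriv_right_le (f := d) (δ := ‖d 0‖) (K := K) (ε := 0)
      (fun t ht => (hd' t ht).continuousAt.continuousWithinAt)
      (fun t ht => (hd' t (Ico_subset_Icc_self ht)).hasDerivWithinAt) le_rfl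
      (fun t ht => by simpa using hlip t (Ico_subset_Icc_self ht)) t ht
    rw [gronwallBound_ε0, sub_zero] at this
    refine this.trans ?_
    gcongr
    exact ht.2
  set B : ℝ := ‖d 0‖ * Real.exp (K * T) with hB
  have hB0 : 0 ≤ B := by positivity
  have hlin : ∀ t ∈ Icc 0 T, ‖d t - d 0‖ ≤ K * B * T := fun t ht => by
    have := (convex_Icc 0 T).norm_image_sub_le_of_norm_hasDerivWithin_le (C := K * B)
      (fun t ht => (hd' t ht).hasDerivWithinAt)
      (fun t ht => (hlip t ht).trans (by gcongr; exact hgr t ht)) (left_mem_Icc.2 hT) ht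
    refine this.trans ?_
    rw [sub_zero, Real.norm_of_nonneg ht.1]
    gcongr
    exact ht.2
  -- The derivative of `d t - t • D (d 0)` splits into the error of linearising `V` and the drift `D
  -- (d t - d 0)`, which is itself of order `T`.
  have := (convex_Icc 0 T).norm_image_sub_le_of_norm_hasDerivWithin_le
    (f := fun t => d t - t • D (d 0)) (C := ε * B + ‖D‖ * (K * B * T))
    (fun t ht => ((hd' t ht).sub ((hasDerivAt_id t).smul_const (D (d 0)))).hasDerivWithinAt)
    (fun t ht => ?_) (left_mem_Icc.2 hT) (right_mem_Icc.2 hT)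
  · rw [sub_zero, Real.norm_of_nonneg hT, zero_smul, sub_zero] at this
    calc ‖d T - d 0 - T • D (d 0)‖ = ‖d T - T • D (d 0) - d 0‖ := by congr 1; abel
      _ ≤ _ := this
      _ = _ := by rw [hB]; ring
  · rw [one_smul]
    calc ‖V (x t) - V (y t) - D (d 0)‖
        = ‖(V (x t) - V (y t) - D (d t)) + D (d t - d 0)‖ := by
          congr 1; rw [D.map_sub (d t) (d 0)]; abel
      _ ≤ ‖V (x t) - V (y t) - D (d t)‖ + ‖D (d t - d 0)‖ := norm_add_le _ _
      _ ≤ ε * B + ‖D‖ * (K * B * T) := by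
        refine add_le_add ((happ t ht).trans (by gcongr; exact hgr t ht)) ?_
        exact (D.le_opNorm _).trans (by gcongr; exact hlin t ht)

/-- The derivatives `A t` of the time `t` maps of a local flow at a point satisfy
`A t = 1 + t D + o(t)`, where `D` is the derivative of the vector field. -/
lemma tendsto_slope_fderiv_flow {E : Type*} [NormedAddCommGroup E] [NormedSpace ℝ E]
    {V : E → E} {z₀ : E} {D : E →L[ℝ] E} (hV : HasStrictFDerivAt V D z₀) {F : E × ℝ → E}
    (hF0 : ∀ᶠ x in 𝓝 z₀, F (x, 0) = x) (hFc : Tendsto F (𝓝 (z₀, 0)) (𝓝 z₀))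
    (hF : ∀ᶠ p in 𝓝 (z₀, (0 : ℝ)), HasDerivAt (fun t => F (p.1, t)) (V (F p)) p.2)
    {A : ℝ → E →L[ℝ] E} (hA : ∀ᶠ t in 𝓝[>] (0 : ℝ), HasFDerivAt (fun x => F (x, t)) (A t) z₀) :
    Tendsto (fun t : ℝ => t⁻¹ • (A t - ContinuousLinearMap.id ℝ E)) (𝓝[>] 0) (𝓝 D) := by
  rw [Metric.tendsto_nhds]
  intro c hc
  -- Strictness leaves room: the error constant below tends to `ε` as `T → 0`, hence is eventually
  -- less than `c`.
  obtain ⟨ε, hε0, hεc⟩ : ∃ ε : NNReal, 0 < ε ∧ (ε : ℝ) < c := by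
    lift c to NNReal using hc.le
    obtain ⟨ε, h1, h2⟩ := exists_between (NNReal.coe_pos.1 hc)
    exact ⟨ε, h1, h2⟩
  obtain ⟨s, hs, hVs⟩ := hV.approximates_deriv_on_nhds (c := ε) (Or.inr hε0)
  have hev := (hFc.eventually hs).and hF
  -- A rectangle inside the product neighbourhood gives one time bound for all nearby initial
  -- values.
  rw [nhds_prod_eq, eventually_prod_iff] at hev
  obtain ⟨pa, hpa, pb, hpb, hab⟩ := hev
  obtain ⟨δ, hδ, hδb⟩ := Metric.eventually_nhds_iff.1 hpb
  have hlim : Tendsto (fun T : ℝ => (ε + ‖D‖ * (‖D‖ + ε) * T) * Real.exp ((‖D‖ + ε) * T))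
      (𝓝[>] 0) (𝓝 ε) := by
    have : Continuous fun T : ℝ => (ε + ‖D‖ * (‖D‖ + ε) * T) * Real.exp ((‖D‖ + ε) * T) := by
      fun_prop
    simpa using (this.tendsto 0).mono_left nhdsWithin_le_nhds
  filter_upwards [hA, hlim.eventually (gt_mem_nhds hεc), self_mem_nhdsWithin,
    Ioo_mem_nhdsGT hδ] with T hAT hcT (hT0 : 0 < T) hTδ
  have hb : ∀ t ∈ Icc 0 T, pb t := fun t ht => hδb (by
    rw [Real.dist_eq, sub_zero, abs_of_nonneg ht.1]; exact ht.2.trans_lt hTδ.2)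
  have hz : F (z₀, 0) = z₀ := hF0.self_of_nhds
  set C := (ε + ‖D‖ * (‖D‖ + ε) * T) * Real.exp ((‖D‖ + ε) * T) with hC
  have hC0 : 0 ≤ C := by positivity
  have hle : ‖A T - (ContinuousLinearMap.id ℝ E + T • D)‖ ≤ C * T := by
    -- A Lipschitz bound at `z₀` for `F (·, T) - (1 + T D)` bounds the operator norm of its
    -- derivative.
    refine (hAT.sub (ContinuousLinearMap.id ℝ E + T • D).hasFDerivAt).le_of_lip'
      (by positivity) ?_
    filter_upwards [hpa, hF0] with x hx hx0
    have := norm_sub_sub_le_of_approximatesLinearOn hVs (x := fun t => F (x, t))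
      (y := fun t => F (z₀, t)) (fun t ht => (hab hx (hb t ht)).2)
      (fun t ht => (hab hpa.self_of_nhds (hb t ht)).2) (fun t ht => (hab hx (hb t ht)).1)
      (fun t ht => (hab hpa.self_of_nhds (hb t ht)).1) hT0.le
    simp only [hx0, hz] at this
    calc _ = ‖F (x, T) - F (z₀, T) - (x - z₀) - T • D (x - z₀)‖ := by
          congr 1
          simp only [Pi.sub_apply, add_apply, ContinuousLinearMap.id_apply,
            smul_apply, map_sub, smul_sub]
          abel
      _ ≤ _ := this
      _ = _ := by rw [hC]; ring
  have heq : T⁻¹ • (A T - ContinuousLinearMap.id ℝ E) - D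
      = T⁻¹ • (A T - (ContinuousLinearMap.id ℝ E + T • D)) := by
    rw [← sub_sub, smul_sub _ _ (T • D), smul_smul, inv_mul_cancel₀ hT0.ne', one_smul]
  rw [dist_eq_norm, heq, norm_smul, norm_inv, Real.norm_of_nonneg hT0.le]
  calc T⁻¹ * _ ≤ T⁻¹ * (C * T) := by gcongr
    _ = C := by field_simp
    _ < c := hcT

/-- A quadratic estimate for the difference between two solutions of `x' = V x` and a solution of
the linearised equation. -/
lemma norm_sub_sub_le_of_lipschitz_fderiv {E : Type*} [NormedAddCommGroup E]
    [NormedSpace ℝ E] {V : E → E} {V' : E → E →L[ℝ] E} {s : Set E} {K M : ℝ} (hK : 0 ≤ K)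
    (hV : ∀ a ∈ s, ∀ b ∈ s, ‖V a - V b - V' b (a - b)‖ ≤ M * ‖a - b‖ ^ 2) (hM : 0 ≤ M)
    (hVs : ∀ a ∈ s, ∀ b ∈ s, ‖V a - V b‖ ≤ K * ‖a - b‖) (hV's : ∀ a ∈ s, ‖V' a‖ ≤ K)
    {x y : ℝ → E} {L : ℝ → E →L[ℝ] E} {T : ℝ}
    (hx : ∀ t ∈ Icc 0 T, HasDerivAt x (V (x t)) t) (hy : ∀ t ∈ Icc 0 T, HasDerivAt y (V (y t)) t)
    (hL : ∀ t ∈ Icc 0 T, HasDerivAt L ((V' (y t)).comp (L t)) t)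
    (hL0 : L 0 = ContinuousLinearMap.id ℝ E)
    (hxs : ∀ t ∈ Icc 0 T, x t ∈ s) (hys : ∀ t ∈ Icc 0 T, y t ∈ s) (hT : 0 ≤ T) :
    ‖x T - y T - L T (x 0 - y 0)‖ ≤
      gronwallBound 0 K (M * Real.exp (K * T) ^ 2) T * ‖x 0 - y 0‖ ^ 2 := by
  set d : ℝ → E := fun t => x t - y t with hd
  have hd' : ∀ t ∈ Icc 0 T, HasDerivAt d (V (x t) - V (y t)) t := fun t ht =>
    (hx t ht).sub (hy t ht)
  have hgr : ∀ t ∈ Icc 0 T, ‖d t‖ ≤ ‖d 0‖ * Real.exp (K * T) := fun t ht => by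
    have := norm_le_gronwallBound_of_norm_deriv_right_le (f := d) (δ := ‖d 0‖) (K := K) (ε := 0)
      (fun t ht => (hd' t ht).continuousAt.continuousWithinAt)
      (fun t ht => (hd' t (Ico_subset_Icc_self ht)).hasDerivWithinAt) le_rfl
      (fun t ht => by
        simpa using hVs _ (hxs t (Ico_subset_Icc_self ht)) _ (hys t (Ico_subset_Icc_self ht))) t ht
    rw [gronwallBound_ε0, sub_zero] at this
    refine this.trans ?_
    gcongr
    exact ht.2
  -- The deviation from the linearised solution solves the linearised equation up to a forcing term
  -- quadratic in `d`; Grönwall applies with initial value zero.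
  set e : ℝ → E := fun t => d t - L t (d 0) with he
  have he' : ∀ t ∈ Icc 0 T, HasDerivAt e (V (x t) - V (y t) - V' (y t) (L t (d 0))) t :=
    fun t ht => by
      convert! (hd' t ht).sub ((hL t ht).clm_apply (hasDerivAt_const t (d 0))) using 1
      simp
  have he0 : e 0 = 0 := by simp [he, hL0]
  have hbd : ∀ t ∈ Ico 0 T, ‖V (x t) - V (y t) - V' (y t) (L t (d 0))‖ ≤
      K * ‖e t‖ + M * Real.exp (K * T) ^ 2 * ‖d 0‖ ^ 2 := fun t ht => by
    have ht := Ico_subset_Icc_self ht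
    calc _ = ‖V' (y t) (e t) + (V (x t) - V (y t) - V' (y t) (x t - y t))‖ := by
          congr 1; simp only [he, hd, map_sub]; abel
      _ ≤ ‖V' (y t) (e t)‖ + ‖V (x t) - V (y t) - V' (y t) (x t - y t)‖ := norm_add_le _ _
      _ ≤ K * ‖e t‖ + M * (‖d 0‖ * Real.exp (K * T)) ^ 2 := by
        refine add_le_add (((V' (y t)).le_opNorm _).trans ?_)
          ((hV _ (hxs t ht) _ (hys t ht)).trans ?_)
        · gcongr; exact hV's _ (hys t ht)
        · gcongr; exact hgr t ht
      _ = _ := by ring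
  have := norm_le_gronwallBound_of_norm_deriv_right_le (f := e) (δ := 0)
    (fun t ht => (he' t ht).continuousAt.continuousWithinAt)
    (fun t ht => (he' t (Ico_subset_Icc_self ht)).hasDerivWithinAt) (by simp [he0]) hbd T
    (right_mem_Icc.2 hT)
  refine this.trans (le_of_eq ?_)
  rw [sub_zero]
  -- With zero initial value the Grönwall bound is linear in the forcing, so `‖d 0‖ ^ 2` factors
  -- out; its formula is separate for `K = 0`.
  by_cases hK' : K = 0
  · simp only [hK', gronwallBound_K0]; ring
  · simp only [gronwallBound_of_K_ne_0 hK']; ring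

/-- Near a point, a `C²` map is approximated by its derivative with a quadratic error. -/
lemma exists_quadratic_bound {E : Type*} [NormedAddCommGroup E]
    [NormedSpace ℝ E] {V : E → E} {z₀ : E} (hV : ContDiffAt ℝ 2 V z₀) :
    ∃ s ∈ 𝓝 z₀, ∃ K M : ℝ, 0 ≤ K ∧ 0 ≤ M ∧
      (∀ a ∈ s, ∀ b ∈ s, ‖V a - V b - fderiv ℝ V b (a - b)‖ ≤ M * ‖a - b‖ ^ 2) ∧
      (∀ a ∈ s, ∀ b ∈ s, ‖V a - V b‖ ≤ K * ‖a - b‖) ∧ ∀ a ∈ s, ‖fderiv ℝ V a‖ ≤ K := by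
  have hV' : ContDiffAt ℝ 1 (fderiv ℝ V) z₀ := hV.fderiv_right (by norm_num)
  obtain ⟨M, s₁, hs₁, hM⟩ := hV'.exists_lipschitzOnWith
  have hd : ∀ᶠ z in 𝓝 z₀, DifferentiableAt ℝ V z :=
    (hV.eventually (by simp)).mono fun z hz => hz.differentiableAt (by simp)
  have hbd : ∀ᶠ z in 𝓝 z₀, ‖fderiv ℝ V z‖ < ‖fderiv ℝ V z₀‖ + 1 :=
    hV'.continuousAt.norm.eventually (gt_mem_nhds (lt_add_one _))
  obtain ⟨r, hr, hball⟩ := Metric.mem_nhds_iff.1 (inter_mem (inter_mem hs₁ hd) hbd)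
  refine ⟨Metric.ball z₀ r, Metric.ball_mem_nhds _ hr, ‖fderiv ℝ V z₀‖ + 1, M, by positivity,
    by positivity, fun a ha b hb => ?_, fun a ha b hb => ?_, fun a ha => (hball ha).2.le⟩
  · have hseg : segment ℝ b a ⊆ Metric.ball z₀ r := (convex_ball z₀ r).segment_subset hb ha
    -- On the segment, rather than the whole ball, the derivative differs from its value at `b` by
    -- at most `M * ‖a - b‖`; this makes the error quadratic.
    have := (convex_segment b a).norm_image_sub_le_of_norm_hasFDerivWithin_le' (f := V)
      (f' := fderiv ℝ V) (φ := fderiv ℝ V b) (C := M * ‖a - b‖)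
      (fun z hz => (hball (hseg hz)).1.2.hasFDerivAt.hasFDerivWithinAt)
      (fun z hz => (hM.norm_sub_le (hball (hseg hz)).1.1 (hball hb).1.1).trans ?_)
      (left_mem_segment ℝ b a) (right_mem_segment ℝ b a)
    · exact this.trans (le_of_eq (by ring))
    · gcongr
      obtain ⟨θ, hθ, rfl⟩ := (segment_eq_image' ℝ b a).subset hz
      rw [add_sub_cancel_left, norm_smul, Real.norm_of_nonneg hθ.1]
      exact mul_le_of_le_one_left (norm_nonneg _) hθ.2
  · exact (convex_ball z₀ r).norm_image_sub_le_of_norm_fderiv_le (f := V)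
      (fun z hz => (hball hz).1.2) (fun z hz => (hball hz).2.le) hb ha

/-- The time `t` maps of a local flow of a `C²` vector field are differentiable at the base point
for small `t`. -/
lemma eventually_differentiableAt_flow {E : Type*} [NormedAddCommGroup E] [NormedSpace ℝ E]
    [CompleteSpace E] {V : E → E} {z₀ : E} (hV : ContDiffAt ℝ 2 V z₀) {F : E × ℝ → E}
    (hF0 : ∀ᶠ x in 𝓝 z₀, F (x, 0) = x) (hFc : Tendsto F (𝓝 (z₀, 0)) (𝓝 z₀))
    (hF : ∀ᶠ p in 𝓝 (z₀, (0 : ℝ)), HasDerivAt (fun t => F (p.1, t)) (V (F p)) p.2) :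
    ∀ᶠ t in 𝓝[>] (0 : ℝ), DifferentiableAt ℝ (fun x => F (x, t)) z₀ := by
  obtain ⟨s, hs, K, M, hK, hM, hV₁, hV₂, hV₃⟩ := exists_quadratic_bound hV
  -- The equation is coupled with its linearisation `L' = DV(z) L`. The coupled field is `C¹`
  -- because `V` is `C²`, and its second component is the candidate derivative.
  have hW : ContDiffAt ℝ 1 (fun p : E × (E →L[ℝ] E) => (V p.1, (fderiv ℝ V p.1).comp p.2))
      (z₀, ContinuousLinearMap.id ℝ E) := by
    have h1 : ContDiffAt ℝ 1 (fun p : E × (E →L[ℝ] E) => V p.1)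
        (z₀, ContinuousLinearMap.id ℝ E) :=
      (hV.of_le (by norm_num)).comp _ contDiffAt_fst
    have h2 : ContDiffAt ℝ 1 (fun p : E × (E →L[ℝ] E) => fderiv ℝ V p.1)
        (z₀, ContinuousLinearMap.id ℝ E) :=
      ContDiffAt.comp (g := fderiv ℝ V) _ (hV.fderiv_right (by norm_num)) contDiffAt_fst
    exact h1.prodMk (h2.clm_comp contDiffAt_snd)
  obtain ⟨G, hG0, -, hG⟩ := exists_local_flow hW
  set c : ℝ → E × (E →L[ℝ] E) := fun t => G ((z₀, ContinuousLinearMap.id ℝ E), t) with hc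
  have hc0 : c 0 = (z₀, ContinuousLinearMap.id ℝ E) := hG0.self_of_nhds
  have hc' : ∀ᶠ t in 𝓝 (0 : ℝ), HasDerivAt c (V (c t).1, (fderiv ℝ V (c t).1).comp (c t).2) t :=
    ((Continuous.prodMk_right _).tendsto (0 : ℝ)).eventually hG
  have hev := (hFc.eventually hs).and hF
  have hev' := ((Continuous.prodMk_right z₀).tendsto (0 : ℝ)).eventually hev
  have hcs : ∀ᶠ t in 𝓝 (0 : ℝ), (c t).1 ∈ s :=
    hc'.self_of_nhds.continuousAt.fst.eventually_mem (by rwa [hc0])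
  have heq : (fun t => F (z₀, t)) =ᶠ[𝓝 0] fun t => (c t).1 := by
    refine ODE_solution_unique_of_eventually (v := fun _ => V) (s := fun _ => s)
      (K := K.toNNReal) (Eventually.of_forall fun t => LipschitzOnWith.of_dist_le_mul ?_)
      (hev'.mono fun t ht => ⟨ht.2, ht.1⟩) ?_ (by rw [hF0.self_of_nhds, hc0])
    · intro a ha b hb
      rw [dist_eq_norm, dist_eq_norm, Real.coe_toNNReal _ hK]
      exact hV₂ a ha b hb
    · filter_upwards [hc', hcs] with t ht hts using ⟨ht.fst, hts⟩
  rw [nhds_prod_eq, eventually_prod_iff] at hev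
  obtain ⟨pa, hpa, pb, hpb, hab⟩ := hev
  obtain ⟨δ, hδ, hδb⟩ := Metric.eventually_nhds_iff.1 (hpb.and (hc'.and heq))
  filter_upwards [self_mem_nhdsWithin, Ioo_mem_nhdsGT hδ] with T (hT0 : 0 < T) hTδ
  have hb : ∀ t ∈ Icc 0 T, _ := fun t ht => hδb (show dist t 0 < δ by
    rw [Real.dist_eq, sub_zero, abs_of_nonneg ht.1]; exact ht.2.trans_lt hTδ.2)
  refine HasFDerivAt.differentiableAt (f' := (c T).2) ?_
  refine HasFDerivAt.of_isLittleO (Asymptotics.IsBigO.trans_isLittleO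
    (g := fun x => ‖x - z₀‖ ^ 2) ?_ ?_)
  · refine Asymptotics.IsBigO.of_bound (gronwallBound 0 K (M * Real.exp (K * T) ^ 2) T) ?_
    filter_upwards [hpa, hF0] with x hx hx0
    have := norm_sub_sub_le_of_lipschitz_fderiv hK hV₁ hM hV₂ hV₃ (x := fun t => F (x, t))
      (y := fun t => F (z₀, t)) (L := fun t => (c t).2) (fun t ht => (hab hx (hb t ht).1).2)
      (fun t ht => (hab hpa.self_of_nhds (hb t ht).1).2)
      (fun t ht => by
        rw [show F (z₀, t) = (c t).1 from (hb t ht).2.2]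
        exact (hb t ht).2.1.snd) (by rw [hc0])
      (fun t ht => (hab hx (hb t ht).1).1)
      (fun t ht => (hab hpa.self_of_nhds (hb t ht).1).1) hT0.le
    simpa only [hx0, hF0.self_of_nhds, norm_pow, norm_norm] using this
  · refine Asymptotics.isLittleO_norm_right.1 ?_
    have := (Asymptotics.isLittleO_pow_id (𝕜 := ℝ) one_lt_two).comp_tendsto
      (k := fun x : E => ‖x - z₀‖) (l' := 𝓝 z₀)
      (by simpa using ((continuous_id.sub (continuous_const (y := z₀))).norm.tendsto z₀))
    exact this

/-! ### Vector fields and flows read in a chart -/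

section
variable {E : Type*} [NormedAddCommGroup E] [NormedSpace ℝ E]
  {M : Type*} [TopologicalSpace M] [ChartedSpace E M]

/-- The vector field `Z` in the coordinates of the chart at `m`, as a function on `M`. -/
def coordRep (m : M) (Z : ∀ x : M, TangentSpace 𝓘(ℝ, E) x) (p : M) : E :=
  mfderiv 𝓘(ℝ, E) 𝓘(ℝ, E) (extChartAt 𝓘(ℝ, E) m) p (Z p)

lemma coordRep_self [IsManifold 𝓘(ℝ, E) ∞ M] (m : M) (Z : ∀ x : M, TangentSpace 𝓘(ℝ, E) x) :
    coordRep m Z m = Z m := by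
  rw [coordRep, mfderiv_extChartAt_self]
  rfl

lemma contMDiffAt_coordRep_iff [IsManifold 𝓘(ℝ, E) ∞ M] {m p : M}
    (hp : p ∈ (chartAt E m).source) {Z : ∀ x : M, TangentSpace 𝓘(ℝ, E) x} :
    ContMDiffAt 𝓘(ℝ, E) 𝓘(ℝ, E).tangent ∞
      (fun x => (⟨x, Z x⟩ : TangentBundle 𝓘(ℝ, E) M)) p ↔
    ContMDiffAt 𝓘(ℝ, E) 𝓘(ℝ, E) ∞ (coordRep m Z) p := by
  have h := (trivializationAt E (TangentSpace 𝓘(ℝ, E)) m).contMDiffAt_section_iff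
    (IB := 𝓘(ℝ, E)) (n := ∞) (s := Z) (x₀ := p) hp
  refine h.trans (Filter.EventuallyEq.contMDiffAt_iff ?_)
  filter_upwards [(chartAt E m).open_source.mem_nhds hp] with q hq
  rw [coordRep, ← TangentBundle.continuousLinearMapAt_trivializationAt hq]
  exact (congrFun (Bundle.Trivialization.coe_linearMapAt_of_mem (R := ℝ)
    (trivializationAt E (TangentSpace 𝓘(ℝ, E)) m) hq) (Z q)).symm

/-- A function on `M` read in the chart at `m`, with its derivative. -/
lemma hasFDerivAt_comp_extChartAt_symm {F : Type*} [NormedAddCommGroup F] [NormedSpace ℝ F]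
    {f : M → F} {m : M} {f' : TangentSpace 𝓘(ℝ, E) m →L[ℝ] F}
    (hf : HasMFDerivAt 𝓘(ℝ, E) 𝓘(ℝ, F) f m f') :
    HasFDerivAt (f ∘ (extChartAt 𝓘(ℝ, E) m).symm) (show E →L[ℝ] F from f')
      (extChartAt 𝓘(ℝ, E) m m) := by
  have := hf.2
  simp only [writtenInExtChartAt, extChartAt_model_space_eq_id, PartialEquiv.refl_coe,
    Function.id_comp, modelWithCornersSelf_coe, range_id] at this
  exact hasFDerivWithinAt_univ.1 this

lemma contDiffAt_comp_extChartAt_symm [IsManifold 𝓘(ℝ, E) ∞ M] {F : Type*} [NormedAddCommGroup F]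
    [NormedSpace ℝ F] {f : M → F} {m p : M} (hp : p ∈ (extChartAt 𝓘(ℝ, E) m).source)
    (hf : ContMDiffAt 𝓘(ℝ, E) 𝓘(ℝ, F) ∞ f p) :
    ContDiffAt ℝ ∞ (f ∘ (extChartAt 𝓘(ℝ, E) m).symm) (extChartAt 𝓘(ℝ, E) m p) := by
  rw [← contMDiffAt_iff_contDiffAt]
  have h := contMDiffOn_extChartAt_symm (I := 𝓘(ℝ, E)) (n := ∞) m
  have h' := (h _ ((extChartAt 𝓘(ℝ, E) m).map_source hp)).contMDiffAt
    ((isOpen_extChartAt_target m).mem_nhds ((extChartAt 𝓘(ℝ, E) m).map_source hp))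
  refine ContMDiffAt.comp _ ?_ h'
  rwa [(extChartAt 𝓘(ℝ, E) m).left_inv hp]

/-- A curve in the chart at `m` with the velocity given by the coordinates of `X` is an integral
curve of `X`. -/
lemma hasMFDerivAt_extChartAt_symm_comp [IsManifold 𝓘(ℝ, E) ∞ M]
    {X : ∀ x : M, TangentSpace 𝓘(ℝ, E) x} {m : M}
    {c : ℝ → E} {t : ℝ} (hct : c t ∈ (extChartAt 𝓘(ℝ, E) m).target)
    (hc : HasDerivAt c (coordRep m X ((extChartAt 𝓘(ℝ, E) m).symm (c t))) t) :
    HasMFDerivAt 𝓘(ℝ, ℝ) 𝓘(ℝ, E) (fun s => (extChartAt 𝓘(ℝ, E) m).symm (c s)) t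
      ((1 : ℝ →L[ℝ] ℝ).smulRight (X ((extChartAt 𝓘(ℝ, E) m).symm (c t)))) := by
  have h1 : MDifferentiableAt 𝓘(ℝ, E) 𝓘(ℝ, E) (extChartAt 𝓘(ℝ, E) m).symm (c t) := by
    have := mdifferentiableWithinAt_extChartAt_symm hct
    rwa [modelWithCornersSelf_coe, range_id, mdifferentiableWithinAt_univ] at this
  have h2 := mfderivWithin_extChartAt_symm_comp_mfderiv_extChartAt hct
  rw [modelWithCornersSelf_coe, range_id, mfderivWithin_univ] at h2
  refine (h1.hasMFDerivAt.comp t hc.hasFDerivAt.hasMFDerivAt).congr_mfderiv ?_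
  refine ContinuousLinearMap.ext fun r : ℝ => ?_
  have h3 := DFunLike.congr_fun h2 (X ((extChartAt 𝓘(ℝ, E) m).symm (c t)))
  exact (map_smul (mfderiv 𝓘(ℝ, E) 𝓘(ℝ, E) (extChartAt 𝓘(ℝ, E) m).symm (c t)) r
    (coordRep (E := E) m X ((extChartAt 𝓘(ℝ, E) m).symm (c t)))).trans (congrArg (r • ·) h3)

/-- Near `m` and for small times, the flow is the flow `F` of an ordinary differential equation in
the chart at `m`. -/
lemma exists_flow_eq_in_chart [CompleteSpace E] [IsManifold 𝓘(ℝ, E) ∞ M] [T2Space M]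
    {X : ∀ x : M, TangentSpace 𝓘(ℝ, E) x} (hX : IsSmoothVectorField X) (m : M) :
    ∃ F : E × ℝ → E, (∀ᶠ z in 𝓝 (extChartAt 𝓘(ℝ, E) m m), F (z, 0) = z) ∧
      Tendsto F (𝓝 (extChartAt 𝓘(ℝ, E) m m, 0)) (𝓝 (extChartAt 𝓘(ℝ, E) m m)) ∧
      (∀ᶠ p in 𝓝 (extChartAt 𝓘(ℝ, E) m m, (0 : ℝ)), HasDerivAt (fun t => F (p.1, t))
        (coordRep m X ((extChartAt 𝓘(ℝ, E) m).symm (F p))) p.2) ∧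
      ∀ᶠ t in 𝓝 (0 : ℝ), ∀ᶠ p in 𝓝 m, FlowDefined X t p ∧
        F (extChartAt 𝓘(ℝ, E) m p, t) ∈ (extChartAt 𝓘(ℝ, E) m).target ∧
        flow X t p = (extChartAt 𝓘(ℝ, E) m).symm (F (extChartAt 𝓘(ℝ, E) m p, t)) := by
  set φ := extChartAt 𝓘(ℝ, E) m with hφ
  have hV : ContDiffAt ℝ ∞ (coordRep m X ∘ φ.symm) (φ m) :=
    contDiffAt_comp_extChartAt_symm (mem_extChartAt_source m)
      ((contMDiffAt_coordRep_iff (mem_chart_source E m)).1 (hX m))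
  obtain ⟨F, hF0, hFc, hF⟩ := exists_local_flow (hV.of_le (by norm_cast))
  refine ⟨F, hF0, hFc, hF, ?_⟩
  have hev := (hFc.eventually ((isOpen_extChartAt_target m).mem_nhds
    (mem_extChartAt_target m))).and hF
  rw [nhds_prod_eq, eventually_prod_iff] at hev
  obtain ⟨pa, hpa, pb, hpb, hab⟩ := hev
  obtain ⟨δ, hδ, hδb⟩ := Metric.eventually_nhds_iff.1 hpb
  filter_upwards [Ioo_mem_nhds (neg_lt_zero.2 hδ) hδ] with t ht
  filter_upwards [(continuousAt_extChartAt (I := 𝓘(ℝ, E)) m).eventually (hpa.and hF0),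
    extChartAt_source_mem_nhds (I := 𝓘(ℝ, E)) m] with p hp hps
  have hI : ∀ s ∈ Ioo (-δ) δ, pb s := fun s hs => hδb (by
    rw [Real.dist_eq, sub_zero]; exact abs_lt.2 hs)
  have hline : IsFlowLine X t p (fun s => φ.symm (F (φ p, s))) := by
    refine ⟨?_, -δ, δ, ⟨neg_lt_zero.2 hδ, hδ⟩, ht, fun s hs => ?_⟩
    · show φ.symm (F (φ p, 0)) = p
      rw [hp.2, φ.left_inv hps]
    · exact (hasMFDerivAt_extChartAt_symm_comp (hab hp.1 (hI s hs)).1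
        (hab hp.1 (hI s hs)).2).hasMFDerivWithinAt
  exact ⟨⟨_, hline⟩, (hab hp.1 (hI t ht)).1, flow_eq hX hline⟩

end

/-! ### The flow to first order, and the bracket of `X` with the gradient -/

section
variable {E : Type*} [NormedAddCommGroup E] [NormedSpace ℝ E]
  {M : Type*} [TopologicalSpace M] [ChartedSpace E M]

/-- The derivative at `m` of the time `t` flow, read in the chart at `m`. -/
def coordFlowDeriv (X : ∀ x : M, TangentSpace 𝓘(ℝ, E) x) (m : M) (t : ℝ) : E →L[ℝ] E :=
  (show TangentSpace 𝓘(ℝ, E) (flow X t m) →L[ℝ] E from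
    mfderiv 𝓘(ℝ, E) 𝓘(ℝ, E) (extChartAt 𝓘(ℝ, E) m) (flow X t m)).comp
  (show E →L[ℝ] TangentSpace 𝓘(ℝ, E) (flow X t m) from
    mfderiv 𝓘(ℝ, E) 𝓘(ℝ, E) (flow X t) m)

/-- First order behaviour of the flow at time `0`, in the chart at `m`. -/
lemma flow_first_order [CompleteSpace E] [IsManifold 𝓘(ℝ, E) ∞ M] [T2Space M]
    {X : ∀ x : M, TangentSpace 𝓘(ℝ, E) x} (hX : IsSmoothVectorField X) (m : M) :
    (∀ᶠ t in 𝓝[>] (0 : ℝ), FlowDefined X t m ∧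
      flow X t m ∈ (chartAt E m).source ∧
      MDifferentiableAt 𝓘(ℝ, E) 𝓘(ℝ, E) (flow X t) m) ∧
    (∀ {f : M → E} {f' : TangentSpace 𝓘(ℝ, E) m →L[ℝ] E},
      HasMFDerivAt 𝓘(ℝ, E) 𝓘(ℝ, E) f m f' →
      Tendsto (fun t : ℝ => t⁻¹ • (f (flow X t m) - f m)) (𝓝[>] 0) (𝓝 (f' (X m)))) ∧
    Tendsto (fun t : ℝ => t⁻¹ • (coordFlowDeriv X m t - ContinuousLinearMap.id ℝ E)) (𝓝[>] 0)
      (𝓝 (show E →L[ℝ] E from mfderiv 𝓘(ℝ, E) 𝓘(ℝ, E) (coordRep m X) m)) := by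
  obtain ⟨F, hF0, hFc, hF, hflow⟩ := exists_flow_eq_in_chart hX m
  set φ := extChartAt 𝓘(ℝ, E) m with hφ
  have hXm : ContMDiffAt 𝓘(ℝ, E) 𝓘(ℝ, E) ∞ (coordRep m X) m :=
    (contMDiffAt_coordRep_iff (mem_chart_source E m)).1 (hX m)
  have hV : ContDiffAt ℝ ∞ (coordRep m X ∘ φ.symm) (φ m) :=
    contDiffAt_comp_extChartAt_symm (mem_extChartAt_source m) hXm
  have hdiff := eventually_differentiableAt_flow (hV.of_le (by norm_cast)) hF0 hFc hF
  have hmd : ∀ᶠ t in 𝓝[>] (0 : ℝ), FlowDefined X t m ∧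
      flow X t m ∈ (chartAt E m).source ∧
      MDifferentiableAt 𝓘(ℝ, E) 𝓘(ℝ, E) (flow X t) m := by
    filter_upwards [nhdsWithin_le_nhds hflow, hdiff] with t ht htd
    have ht' := ht.self_of_nhds
    refine ⟨ht'.1, ?_, ?_⟩
    · rw [ht'.2.2, ← extChartAt_source 𝓘(ℝ, E) m]
      exact φ.map_target ht'.2.1
    · have h1 : MDifferentiableAt 𝓘(ℝ, E) 𝓘(ℝ, E) φ.symm (F (φ m, t)) := by
        have := mdifferentiableWithinAt_extChartAt_symm ht'.2.1
        rwa [modelWithCornersSelf_coe, range_id, mdifferentiableWithinAt_univ] at this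
      have h2 : MDifferentiableAt 𝓘(ℝ, E) 𝓘(ℝ, E) (fun p => F (φ p, t)) m :=
        MDifferentiableAt.comp (g := fun z => F (z, t)) (f := φ) m htd.mdifferentiableAt
          (mdifferentiableAt_extChartAt (mem_chart_source E m))
      exact (MDifferentiableAt.comp (g := φ.symm) m h1 h2).congr_of_eventuallyEq
        (ht.mono fun p hp => hp.2.2)
  have hz : F (φ m, 0) = φ m := hF0.self_of_nhds
  have hmm : φ.symm (φ m) = m := φ.left_inv (mem_extChartAt_source m)
  refine ⟨hmd, fun {f f'} hf => ?_, ?_⟩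
  · have h1 := hasFDerivAt_comp_extChartAt_symm hf
    have h2 := hF.self_of_nhds
    have h3 : HasDerivAt (fun t => (f ∘ φ.symm) (F (φ m, t)))
        ((show E →L[ℝ] E from f') (coordRep m X (φ.symm (F (φ m, 0))))) 0 :=
      HasFDerivAt.comp_hasDerivAt (l := f ∘ φ.symm) (f := fun t => F (φ m, t)) 0
        (by simpa only [hz] using h1) h2
    rw [hz, hmm, coordRep_self] at h3
    have h4 := h3.tendsto_slope_zero_right
    refine h4.congr' ?_
    filter_upwards [nhdsWithin_le_nhds hflow] with t ht
    rw [zero_add, hz, Function.comp_apply, Function.comp_apply, hmm, ht.self_of_nhds.2.2]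
  · have hD := hXm.mdifferentiableAt (by simp)
    have hfd := hasFDerivAt_comp_extChartAt_symm hD.hasMFDerivAt
    have hst := hV.hasStrictFDerivAt' hfd (by simp)
    refine tendsto_slope_fderiv_flow hst hF0 hFc hF ?_
    filter_upwards [hmd, nhdsWithin_le_nhds hflow] with t ht hft
    have h1 := hasFDerivAt_comp_extChartAt_symm
      ((mdifferentiableAt_extChartAt (I := 𝓘(ℝ, E)) ht.2.1).hasMFDerivAt.comp m
        ht.2.2.hasMFDerivAt)
    refine h1.congr_of_eventuallyEq ?_
    have hc : ContinuousAt φ.symm (φ m) := continuousAt_extChartAt_symm m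
    rw [ContinuousAt, hmm] at hc
    -- The whole germ at `φ m` must agree with `F (·, t)`, not just the value, since derivatives are
    -- compared.
    filter_upwards [hc.eventually hft, (isOpen_extChartAt_target m).mem_nhds
      (mem_extChartAt_target m)] with z hz hzt
    rw [φ.right_inv hzt] at hz
    show F (z, t) = φ (flow X t (φ.symm z))
    rw [hz.2.2, φ.right_inv hz.2.1]

/-- A first integral is constant along the flow. -/
lemma IsFirstIntegral.comp_flow {X : ∀ x : M, TangentSpace 𝓘(ℝ, E) x} {h : M → ℝ}
    [IsManifold 𝓘(ℝ, E) ∞ M]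
    (hh : IsFirstIntegral X h) (t : ℝ) : h ∘ flow X t = h := by
  classical
  funext p
  rw [Function.comp_apply, flow]
  split_ifs with H
  · obtain ⟨h0, a, b, h0I, htI, hγ⟩ := H.choose_spec
    set γ := H.choose
    have hder : ∀ s ∈ Ioo a b, HasDerivAt (h ∘ γ) 0 s := fun s hs => by
      have h1 := ((hh.1 (γ s)).mdifferentiableAt (by simp)).hasMFDerivAt.comp s
        ((hγ s hs).hasMFDerivAt (isOpen_Ioo.mem_nhds hs))
      have h2 := hasMFDerivAt_iff_hasFDerivAt.1 h1
      rw [hasDerivAt_iff_hasFDerivAt]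
      refine h2.congr_fderiv (ContinuousLinearMap.ext fun r : ℝ => ?_)
      have h3 : mfderiv 𝓘(ℝ, E) 𝓘(ℝ) h (γ s) (X (γ s)) = 0 := hh.2 (γ s)
      refine (map_smul (mfderiv 𝓘(ℝ, E) 𝓘(ℝ) h (γ s)) r (X (γ s))).trans ?_
      rw [h3, smul_zero]
      exact (smul_zero r).symm
    have := isOpen_Ioo.is_const_of_deriv_eq_zero isPreconnected_Ioo
      (fun s hs => (hder s hs).differentiableAt.differentiableWithinAt)
      (fun s hs => (hder s hs).deriv) htI h0I
    simpa [h0] using this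
  -- Where the flow is undefined its default value is the point itself, so the identity holds on all
  -- of `M`.
  · rfl

variable [FiniteDimensional ℝ E] [IsManifold 𝓘(ℝ, E) ∞ M]

lemma dualMetric_eq_apply_metricSharp (g : RiemMetric E M) (x : M)
    (α β : TangentSpace 𝓘(ℝ, E) x →L[ℝ] ℝ) : dualMetric g x α β = α (metricSharp g x β) :=
  apply_riesz _ _ _ _

lemma dualMetric_self_pos (g : RiemMetric E M) {x : M} {α : TangentSpace 𝓘(ℝ, E) x →L[ℝ] ℝ}
    (hα : α ≠ 0) : 0 < dualMetric g x α α := by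
  refine g.pos x _ fun h0 => hα ?_
  ext w
  rw [← apply_riesz (g.inner x) (g.pos x) α w]
  change g.inner x (metricSharp g x α) w = 0
  rw [h0]; simp

lemma differential_normalizedGradient (g : RiemMetric E M) {h : M → ℝ} {x : M}
    (hx : differential E h x ≠ 0) : differential E h x (normalizedGradient g h x) = 1 := by
  rw [normalizedGradient, map_smul, ← dualMetric_eq_apply_metricSharp, smul_eq_mul,
    inv_mul_cancel₀ (dualMetric_self_pos g hx).ne']

/-- The flow preserves the normalized gradient of a first integral, up to multiples of `X`. -/
lemma IsTransversallyInvariant.apply_mfderiv_flow {g : RiemMetric E M}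
    {X : ∀ x : M, TangentSpace 𝓘(ℝ, E) x} (hg : IsTransversallyInvariant g X) {h : M → ℝ}
    (hh : IsFirstIntegral X h) {t : ℝ} {m : M} (hdef : FlowDefined X t m)
    (hd : MDifferentiableAt 𝓘(ℝ, E) 𝓘(ℝ, E) (flow X t) m)
    {α : TangentSpace 𝓘(ℝ, E) (flow X t m) →L[ℝ] ℝ} (hα : α (X (flow X t m)) = 0) :
    α (mfderiv 𝓘(ℝ, E) 𝓘(ℝ, E) (flow X t) m (normalizedGradient g h m)) =
      α (normalizedGradient g h (flow X t m)) := by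
  have hcomp : (differential E h (flow X t m)).comp (mfderiv 𝓘(ℝ, E) 𝓘(ℝ, E) (flow X t) m) =
      differential E h m := by
    have := mfderiv_comp m ((hh.1 (flow X t m)).mdifferentiableAt (by simp)) hd
    rw [hh.comp_flow t] at this
    exact this.symm
  -- The pair `(dh, dh)` matches the normalising factors at the two points; `(α, dh)` matches the
  -- gradients.
  have h1 := hg t m hdef _ _ (hh.2 (flow X t m)) (hh.2 (flow X t m))
  have h2 := hg t m hdef α _ hα (hh.2 (flow X t m))
  rw [hcomp] at h1 h2
  rw [dualMetric_eq_apply_metricSharp g m, dualMetric_eq_apply_metricSharp] at h2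
  rw [normalizedGradient, normalizedGradient, map_smul, map_smul, map_smul, h1]
  exact congrArg _ h2

/-- The bracket of `X` with the normalized gradient is tangent to `X`, in coordinates. -/
lemma IsTransversallyInvariant.bracket_tangent [T2Space M] {g : RiemMetric E M}
    {X : ∀ x : M, TangentSpace 𝓘(ℝ, E) x} (hX : IsSmoothVectorField X)
    (hg : IsTransversallyInvariant g X) {h : M → ℝ} (hh : IsFirstIntegral X h) {m : M}
    {dX dN : TangentSpace 𝓘(ℝ, E) m →L[ℝ] E}
    (hdX : HasMFDerivAt 𝓘(ℝ, E) 𝓘(ℝ, E) (coordRep m X) m dX)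
    (hdN : HasMFDerivAt 𝓘(ℝ, E) 𝓘(ℝ, E) (coordRep m (normalizedGradient g h)) m dN)
    (α β : E →L[ℝ] ℝ) :
    β (X m) * α (dX (normalizedGradient g h m) - dN (X m)) =
      α (X m) * β (dX (normalizedGradient g h m) - dN (X m)) := by
  have : CompleteSpace E := FiniteDimensional.complete ℝ E
  obtain ⟨hev, hf, hA⟩ := flow_first_order hX m
  rw [hdX.mfderiv] at hA
  set N := normalizedGradient g h with hN
  set u : ℝ → E := fun t => coordFlowDeriv X m t (N m) - coordRep m N (flow X t m) with hu
  have hulim : Tendsto (fun t : ℝ => t⁻¹ • u t) (𝓝[>] 0) (𝓝 (dX (N m) - dN (X m))) := by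
    -- Both terms of `u` equal `N m` at time `0`, so the limit is the difference of their
    -- first-order terms.
    have h1 := (((ContinuousLinearMap.apply (E := E) ℝ E (N m)).continuous.tendsto _).comp hA).sub
      (hf hdN)
    refine h1.congr fun t => ?_
    rw [coordRep_self]
    have h2 : ∀ (A : E →L[ℝ] E) (a n : E), t⁻¹ • (A - ContinuousLinearMap.id ℝ E) n -
        t⁻¹ • (a - n) = t⁻¹ • (A n - a) := fun A a n => by
      rw [← smul_sub, sub_apply, ContinuousLinearMap.id_apply, sub_sub_sub_cancel_right]
    exact h2 _ _ _
  have hXlim : Tendsto (fun t : ℝ => coordRep m X (flow X t m)) (𝓝[>] 0) (𝓝 (X m)) := by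
    have h0 : Tendsto (fun t : ℝ => t) (𝓝[>] (0 : ℝ)) (𝓝 0) := nhdsWithin_le_nhds
    have h1 := (h0.smul (hf hdX)).add_const (coordRep m X m)
    rw [zero_smul, zero_add, coordRep_self] at h1
    refine h1.congr' ?_
    filter_upwards [self_mem_nhdsWithin] with t (ht : 0 < t)
    rw [smul_smul, mul_inv_cancel₀ ht.ne', one_smul]
    exact sub_add_cancel _ _
  have hL := ((β.continuous.tendsto _).comp hXlim).mul ((α.continuous.tendsto _).comp hulim)
  have hR := ((α.continuous.tendsto _).comp hXlim).mul ((β.continuous.tendsto _).comp hulim)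
  refine tendsto_nhds_unique_of_eventuallyEq hL hR ?_
  filter_upwards [hev] with t ⟨hdef, hsrc, hd⟩
  simp only [Function.comp_apply, map_smul, smul_eq_mul]
  set T : TangentSpace 𝓘(ℝ, E) (flow X t m) →L[ℝ] E :=
    mfderiv 𝓘(ℝ, E) 𝓘(ℝ, E) (extChartAt 𝓘(ℝ, E) m) (flow X t m) with hT
  -- The combination `β(X) α - α(X) β`, with coefficients taken at the moving point, kills `X` there
  -- and varies continuously as `t → 0⁺`.
  have key := hg.apply_mfderiv_flow hh hdef hd
    (α := (β (coordRep m X (flow X t m)) • α - α (coordRep m X (flow X t m)) • β).comp T)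
    (by
      show β (coordRep m X (flow X t m)) * α (coordRep m X (flow X t m)) -
        α (coordRep m X (flow X t m)) * β (coordRep m X (flow X t m)) = 0
      ring)
  change β (coordRep m X (flow X t m)) * α (coordFlowDeriv X m t (N m)) -
      α (coordRep m X (flow X t m)) * β (coordFlowDeriv X m t (N m)) =
    β (coordRep m X (flow X t m)) * α (coordRep m N (flow X t m)) -
      α (coordRep m X (flow X t m)) * β (coordRep m N (flow X t m)) at key
  simp only [hu, map_sub]
  linear_combination t⁻¹ * key

end

/-! ### Smoothness of the normalized gradient and of wedges -/

section
variable {E : Type*} [NormedAddCommGroup E] [NormedSpace ℝ E]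
  {M : Type*} [TopologicalSpace M] [ChartedSpace E M] [IsManifold 𝓘(ℝ, E) ∞ M]

/-- The coordinates of a differential are the derivative of the function read in the chart. -/
lemma differential_eq_fderiv_coordRep {h : M → ℝ} (hh : ContMDiff 𝓘(ℝ, E) 𝓘(ℝ) ∞ h) {m p : M}
    (hp : p ∈ (chartAt E m).source) (v : ∀ x : M, TangentSpace 𝓘(ℝ, E) x) :
    differential E h p (v p) =
      fderiv ℝ (h ∘ (extChartAt 𝓘(ℝ, E) m).symm) (extChartAt 𝓘(ℝ, E) m p) (coordRep m v p) := by
  set φ := extChartAt 𝓘(ℝ, E) m with hφ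
  have hps : p ∈ φ.source := by rwa [hφ, extChartAt_source]
  have h1 := (contDiffAt_comp_extChartAt_symm hps (hh p)).differentiableAt (by simp)
  have h2 : mfderiv 𝓘(ℝ, E) 𝓘(ℝ) ((h ∘ φ.symm) ∘ φ) p =
      (mfderiv 𝓘(ℝ, E) 𝓘(ℝ) (h ∘ φ.symm) (φ p)).comp (mfderiv 𝓘(ℝ, E) 𝓘(ℝ, E) φ p) :=
    mfderiv_comp p h1.mdifferentiableAt (mdifferentiableAt_extChartAt hp)
  have h3 : (h ∘ φ.symm) ∘ φ =ᶠ[𝓝 p] h := by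
    filter_upwards [(isOpen_extChartAt_source m).mem_nhds hps] with q hq
    simp only [Function.comp_apply]
    rw [φ.left_inv hq]
  rw [h3.mfderiv_eq, mfderiv_eq_fderiv] at h2
  exact DFunLike.congr_fun h2 (v p)

lemma contMDiffAt_fderiv_comp_extChartAt_symm {h : M → ℝ} (hh : ContMDiff 𝓘(ℝ, E) 𝓘(ℝ) ∞ h)
    (m : M) : ContMDiffAt 𝓘(ℝ, E) 𝓘(ℝ, E →L[ℝ] ℝ) ∞ (fun p =>
      fderiv ℝ (h ∘ (extChartAt 𝓘(ℝ, E) m).symm) (extChartAt 𝓘(ℝ, E) m p)) m := by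
  have h1 := (contDiffAt_comp_extChartAt_symm (mem_extChartAt_source m) (hh m)).fderiv_right
    (m := ∞) (by norm_cast)
  exact ContMDiffAt.comp (g := fderiv ℝ (h ∘ (extChartAt 𝓘(ℝ, E) m).symm)) m
    h1.contMDiffAt contMDiffAt_extChartAt

/-- The chart differential is invertible at `p`. Hence identities of linear maps on `E` may be
tested on coordinates of fields; `Z` need not be smooth. -/
lemma exists_coordRep_eq {m p : M} (hp : p ∈ (chartAt E m).source) (w : E) :
    ∃ Z : ∀ x : M, TangentSpace 𝓘(ℝ, E) x, coordRep m Z p = w := by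
  obtain ⟨v, hv⟩ := (isInvertible_mfderiv_extChartAt (I := 𝓘(ℝ, E)) (x := m) (y := p)
    (by rwa [extChartAt_source])).bijective.2 (w : TangentSpace 𝓘(ℝ, E) (extChartAt 𝓘(ℝ, E) m p))
  exact ⟨fun q => (show TangentSpace 𝓘(ℝ, E) q from (v : E)), hv⟩

lemma eventually_differential_ne_zero {h : M → ℝ} (hh : ContMDiff 𝓘(ℝ, E) 𝓘(ℝ) ∞ h) {m : M}
    (hm : differential E h m ≠ 0) : ∀ᶠ p in 𝓝 m, differential E h p ≠ 0 := by
  have hc : fderiv ℝ (h ∘ (extChartAt 𝓘(ℝ, E) m).symm) (extChartAt 𝓘(ℝ, E) m m) ≠ 0 := by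
    intro h0
    refine hm (ContinuousLinearMap.ext fun v => ?_)
    obtain ⟨Z, rfl⟩ : ∃ Z : ∀ x : M, TangentSpace 𝓘(ℝ, E) x, Z m = v := ⟨fun _ => v, rfl⟩
    rw [differential_eq_fderiv_coordRep hh (mem_chart_source E m) Z, h0]
    rfl
  filter_upwards [(contMDiffAt_fderiv_comp_extChartAt_symm hh m).continuousAt.eventually_ne hc,
    (chartAt E m).open_source.mem_nhds (mem_chart_source E m)] with p hp hps h0
  refine hp (ContinuousLinearMap.ext fun w => ?_)
  obtain ⟨Z, rfl⟩ := exists_coordRep_eq hps w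
  rw [← differential_eq_fderiv_coordRep hh hps Z, h0]
  rfl

/-- The metric in the coordinates of the chart at `m`. -/
def coordMetric (g : RiemMetric E M) (m p : M) : E →L[ℝ] E →L[ℝ] ℝ :=
  ContinuousLinearMap.inCoordinates E (fun x : M => TangentSpace 𝓘(ℝ, E) x) (E →L[ℝ] ℝ)
    (fun x : M => TangentSpace 𝓘(ℝ, E) x →L[ℝ] ℝ) m p m p (g.inner p)

lemma contMDiffAt_coordMetric (g : RiemMetric E M) (m : M) :
    ContMDiffAt 𝓘(ℝ, E) 𝓘(ℝ, E →L[ℝ] E →L[ℝ] ℝ) ∞ (coordMetric g m) m :=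
  ((contMDiffAt_hom_bundle _).1 (g.contMDiff m)).2

lemma symm_coordRep {m p : M} (hp : p ∈ (chartAt E m).source)
    (Z : ∀ x : M, TangentSpace 𝓘(ℝ, E) x) :
    (trivializationAt E (TangentSpace 𝓘(ℝ, E)) m).symm p (coordRep m Z p) = Z p := by
  rw [coordRep, ← TangentBundle.continuousLinearMapAt_trivializationAt hp]
  exact (trivializationAt E (TangentSpace 𝓘(ℝ, E)) m).symm_linearMapAt (R := ℝ) hp (Z p)

lemma coordMetric_coordRep (g : RiemMetric E M) {m p : M} (hp : p ∈ (chartAt E m).source)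
    (Z W : ∀ x : M, TangentSpace 𝓘(ℝ, E) x) :
    coordMetric g m p (coordRep m Z p) (coordRep m W p) = g.inner p (Z p) (W p) := by
  rw [coordMetric, inCoordinates_apply_eq₂ hp hp (by simp), symm_coordRep hp, symm_coordRep hp]
  simp

/-- Inverting the cotangent trivialization amounts to composing with the chart differential; this
identifies the coordinates of a wedge with the wedge of the coordinates. -/
lemma cotangent_symm_apply {m p : M} (hp : p ∈ (chartAt E m).source) (α : E →L[ℝ] ℝ)
    (Z : ∀ x : M, TangentSpace 𝓘(ℝ, E) x) :
    (trivializationAt (E →L[ℝ] ℝ) (fun x : M => TangentSpace 𝓘(ℝ, E) x →L[ℝ] ℝ) m).symm p α (Z p) =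
      α (coordRep m Z p) := by
  set e := trivializationAt (E →L[ℝ] ℝ) (fun x : M => TangentSpace 𝓘(ℝ, E) x →L[ℝ] ℝ) m with he
  set ξ : TangentSpace 𝓘(ℝ, E) p →L[ℝ] ℝ := α.comp
    (show TangentSpace 𝓘(ℝ, E) p →L[ℝ] E from
      mfderiv 𝓘(ℝ, E) 𝓘(ℝ, E) (extChartAt 𝓘(ℝ, E) m) p) with hξ
  have hpe : p ∈ e.baseSet := by simpa [he] using hp
  have h1 : (e ⟨p, ξ⟩).2 = α := by
    rw [he, hom_trivializationAt_apply]
    refine ContinuousLinearMap.ext fun w => ?_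
    obtain ⟨W, rfl⟩ := exists_coordRep_eq hp w
    rw [ContinuousLinearMap.inCoordinates_eq hp (by simp)]
    simp only [ContinuousLinearMap.comp_apply, ContinuousLinearEquiv.coe_coe]
    have h2 := symm_coordRep hp W
    exact congrArg ξ h2
  have h2 := e.symm_apply_apply_mk hpe ξ
  rw [h1] at h2
  rw [h2]
  rfl

/-- The wedge of two smooth vector fields is a smooth bivector field. -/
lemma contMDiff_wedge {Y X : ∀ x : M, TangentSpace 𝓘(ℝ, E) x} (hY : IsSmoothVectorField Y)
    (hX : IsSmoothVectorField X) :
    ContMDiff 𝓘(ℝ, E) (𝓘(ℝ, E).prod 𝓘(ℝ, (E →L[ℝ] ℝ) →L[ℝ] (E →L[ℝ] ℝ) →L[ℝ] ℝ)) ∞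
    (fun x => Bundle.TotalSpace.mk' ((E →L[ℝ] ℝ) →L[ℝ] (E →L[ℝ] ℝ) →L[ℝ] ℝ)
      (E := fun x : M => Bivec (TangentSpace 𝓘(ℝ, E) x)) x (wedge (Y x) (X x))) := by
  intro m
  refine (contMDiffAt_hom_bundle _).2 ⟨contMDiffAt_id, ?_⟩
  have hw : ContDiff ℝ ∞ (fun q : E × E => wedge q.1 q.2) := by
    -- This form shows that evaluation depends linearly and continuously on `v`, which makes the
    -- wedge visibly smooth.
    have he : ∀ v : E, evalAt v = ContinuousLinearMap.apply ℝ ℝ v := fun v => rfl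
    simp only [wedge, he]
    fun_prop
  have hY' := (contMDiffAt_coordRep_iff (mem_chart_source E m)).1 (hY m)
  have hX' := (contMDiffAt_coordRep_iff (mem_chart_source E m)).1 (hX m)
  refine (ContMDiffAt.comp (g := fun q : E × E => wedge q.1 q.2)
    (f := fun p => (coordRep m Y p, coordRep m X p)) m
    hw.contMDiff.contMDiffAt (hY'.prodMk_space hX')).congr_of_eventuallyEq ?_
  filter_upwards [(chartAt E m).open_source.mem_nhds (mem_chart_source E m)] with p hp
  refine ContinuousLinearMap.ext fun α => ContinuousLinearMap.ext fun β => ?_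
  rw [inCoordinates_apply_eq₂ (by simpa using hp) (by simpa using hp) (by simp)]
  simp [cotangent_symm_apply hp]

variable [FiniteDimensional ℝ E]

/-- Positivity gives injectivity, and the dimensions agree. Operator inversion is smooth at
invertible operators, so the dual metric is smooth. -/
lemma isInvertible_coordMetric (g : RiemMetric E M) {m p : M} (hp : p ∈ (chartAt E m).source) :
    (coordMetric g m p).IsInvertible := by
  have hinj : Function.Injective (coordMetric g m p) := by
    refine (injective_iff_map_eq_zero _).2 fun v hv => ?_
    obtain ⟨Z, rfl⟩ := exists_coordRep_eq hp v
    by_contra hne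
    have hZ : Z p ≠ 0 := fun h0 => hne (by rw [coordRep, h0]; exact map_zero _)
    have := g.pos p (Z p) hZ
    rw [← coordMetric_coordRep g hp Z Z, hv] at this
    exact lt_irrefl _ this
  have hdim : Module.finrank ℝ E = Module.finrank ℝ (E →L[ℝ] ℝ) := by
    rw [← (LinearMap.toContinuousLinearMap : (E →ₗ[ℝ] ℝ) ≃ₗ[ℝ] _).finrank_eq]
    exact (Subspace.dual_finrank_eq (K := ℝ) (V := E)).symm
  refine ⟨(LinearEquiv.ofInjectiveOfFinrankEq (coordMetric g m p).toLinearMap hinj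
    hdim).toContinuousLinearEquiv, ?_⟩
  ext; rfl

lemma contMDiffAt_coordRep_metricSharp_differential (g : RiemMetric E M) {h : M → ℝ}
    (hh : ContMDiff 𝓘(ℝ, E) 𝓘(ℝ) ∞ h) (m : M) :
    ContMDiffAt 𝓘(ℝ, E) 𝓘(ℝ, E) ∞
      (coordRep m fun x => metricSharp g x (differential E h x)) m := by
  have hinv : ContMDiffAt 𝓘(ℝ, E) 𝓘(ℝ, (E →L[ℝ] ℝ) →L[ℝ] E) ∞
      (fun p => (coordMetric g m p).inverse) m :=
    ContMDiffAt.comp (g := ContinuousLinearMap.inverse) m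
      ((isInvertible_coordMetric g (mem_chart_source E m)).contDiffAt_map_inverse).contMDiffAt
      (contMDiffAt_coordMetric g m)
  refine (hinv.clm_apply (contMDiffAt_fderiv_comp_extChartAt_symm hh m)).congr_of_eventuallyEq ?_
  filter_upwards [(chartAt E m).open_source.mem_nhds (mem_chart_source E m)] with p hp
  have h1 : coordMetric g m p (coordRep m (fun x => metricSharp g x (differential E h x)) p) =
      fderiv ℝ (h ∘ (extChartAt 𝓘(ℝ, E) m).symm) (extChartAt 𝓘(ℝ, E) m p) := by
    ext w
    obtain ⟨Z, rfl⟩ := exists_coordRep_eq hp w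
    rw [coordMetric_coordRep g hp, ← differential_eq_fderiv_coordRep hh hp Z]
    exact apply_riesz _ _ _ _
  rw [← h1]
  exact ((isInvertible_coordMetric g hp).inverse_apply_eq.2 rfl).symm

lemma contMDiffAt_normalizedGradient (g : RiemMetric E M) {h : M → ℝ}
    (hh : ContMDiff 𝓘(ℝ, E) 𝓘(ℝ) ∞ h) {m : M} (hm : differential E h m ≠ 0) :
    ContMDiffAt 𝓘(ℝ, E) 𝓘(ℝ, E).tangent ∞
      (fun x => (⟨x, normalizedGradient g h x⟩ : TangentBundle 𝓘(ℝ, E) M)) m := by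
  rw [contMDiffAt_coordRep_iff (mem_chart_source E m)]
  have h1 := contMDiffAt_coordRep_metricSharp_differential g hh m
  have h2 : ContMDiffAt 𝓘(ℝ, E) 𝓘(ℝ) ∞
      (fun p => dualMetric g p (differential E h p) (differential E h p)) m := by
    refine ((contMDiffAt_fderiv_comp_extChartAt_symm hh m).clm_apply h1).congr_of_eventuallyEq ?_
    filter_upwards [(chartAt E m).open_source.mem_nhds (mem_chart_source E m)] with p hp
    rw [dualMetric_eq_apply_metricSharp]
    exact differential_eq_fderiv_coordRep hh hp fun x => metricSharp g x (differential E h x)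
  have h3 := (h2.inv₀ (dualMetric_self_pos g hm).ne').smul h1
  refine h3.congr_of_eventuallyEq (Eventually.of_forall fun p => ?_)
  rw [coordRep, normalizedGradient, map_smul]
  rfl

end

/-! ### The Jacobi identity and the global field `Y` -/

lemma sharp_wedge {V : Type*} [AddCommGroup V] [Module ℝ V] [TopologicalSpace V]
    [ContinuousSMul ℝ V] [IsTopologicalAddGroup V] [T2Space V] [FiniteDimensional ℝ V] (v w : V)
    (α : V →L[ℝ] ℝ) : sharp (wedge v w) α = α v • w - α w • v := by
  rw [sharp, LinearEquiv.symm_apply_eq]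
  ext β
  simp [wedge_apply]

/-- The algebra behind the Jacobi identity for `y ∧ x`: it holds when the bracket
`dX y - dY x` is parallel to `x`. -/
lemma jacobi_of_bracket_tangent {V : Type*} [AddCommGroup V] [Module ℝ V] [TopologicalSpace V]
    {dX dY : V →L[ℝ] V} {x y : V}
    (key : ∀ α β : V →L[ℝ] ℝ, β x * α (dX y - dY x) = α x * β (dX y - dY x))
    (α β γ : V →L[ℝ] ℝ) :
    β (dY (α y • x - α x • y)) * γ x + β y * γ (dX (α y • x - α x • y)) -
        β (dX (α y • x - α x • y)) * γ y - β x * γ (dY (α y • x - α x • y)) +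
      (γ (dY (β y • x - β x • y)) * α x + γ y * α (dX (β y • x - β x • y)) -
        γ (dX (β y • x - β x • y)) * α y - γ x * α (dY (β y • x - β x • y))) +
      (α (dY (γ y • x - γ x • y)) * β x + α y * β (dX (γ y • x - γ x • y)) -
        α (dX (γ y • x - γ x • y)) * β y - α x * β (dY (γ y • x - γ x • y))) = 0 := by
  have hβγ := key β γ
  have hγα := key γ α
  have hαβ := key α β
  simp only [map_sub, map_smul, smul_eq_mul] at hβγ hγα hαβ ⊢
  -- The terms in `dX x` and `dY y` cancel in the cyclic sum; the rest is a combination of the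
  -- tangency identities.
  linear_combination -(α y) * hβγ - β y * hγα - γ y * hαβ

section
variable {E : Type*} [NormedAddCommGroup E] [NormedSpace ℝ E]
  {M : Type*} [TopologicalSpace M] [ChartedSpace E M] [IsManifold 𝓘(ℝ, E) ∞ M]

/-- The extended covectors are constant in the chart, so the product rule only differentiates the
coordinates of `Y` and `X`. -/
lemma differential_wedge_chartExtend {Y X : ∀ x : M, TangentSpace 𝓘(ℝ, E) x} {m : M}
    {dY dX : TangentSpace 𝓘(ℝ, E) m →L[ℝ] E}
    (hY : HasMFDerivAt 𝓘(ℝ, E) 𝓘(ℝ, E) (coordRep m Y) m dY)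
    (hX : HasMFDerivAt 𝓘(ℝ, E) 𝓘(ℝ, E) (coordRep m X) m dX)
    (β γ : TangentSpace 𝓘(ℝ, E) m →L[ℝ] ℝ) (w : TangentSpace 𝓘(ℝ, E) m) :
    differential E (fun p => wedge (Y p) (X p) (chartExtend m β p) (chartExtend m γ p)) m w =
      β (dY w) * γ (X m) + β (Y m) * γ (dX w) - β (dX w) * γ (Y m) - β (X m) * γ (dY w) := by
  have hB : ∀ (b c : E →L[ℝ] ℝ) (y x : E), HasFDerivAt
      (fun q : E × E => b q.1 * c q.2 - b q.2 * c q.1)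
      ((b y • c.comp (.snd ℝ E E) + c x • b.comp (.fst ℝ E E)) -
        (b x • c.comp (.fst ℝ E E) + c y • b.comp (.snd ℝ E E))) (y, x) := fun b c y x =>
    (((b.comp (.fst ℝ E E)).hasFDerivAt (x := (y, x))).mul
      ((c.comp (.snd ℝ E E)).hasFDerivAt (x := (y, x)))).sub
    (((b.comp (.snd ℝ E E)).hasFDerivAt (x := (y, x))).mul
      ((c.comp (.fst ℝ E E)).hasFDerivAt (x := (y, x))))
  have hYX : HasMFDerivAt 𝓘(ℝ, E) 𝓘(ℝ, E × E) (fun p => (coordRep m Y p, coordRep m X p)) m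
      (dY.prod dX) := ⟨hY.1.prodMk hX.1, hY.2.prodMk hX.2⟩
  have h1 := HasMFDerivAt.comp (f := fun p => (coordRep m Y p, coordRep m X p)) m
    (hB β γ (coordRep m Y m) (coordRep m X m)).hasMFDerivAt hYX
  have h2 : (fun p => wedge (Y p) (X p) (chartExtend m β p) (chartExtend m γ p)) =
      (fun q : E × E => (show E →L[ℝ] ℝ from β) q.1 * (show E →L[ℝ] ℝ from γ) q.2 -
        (show E →L[ℝ] ℝ from β) q.2 * (show E →L[ℝ] ℝ from γ) q.1) ∘
      fun p => (coordRep m Y p, coordRep m X p) := by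
    funext p
    rw [wedge_apply]
    rfl
  rw [differential, h2, h1.mfderiv, coordRep_self, coordRep_self]
  change (β (Y m) * γ (dX w) + γ (X m) * β (dY w)) - (β (X m) * γ (dY w) + γ (Y m) * β (dX w)) = _
  ring

lemma eventually_ne_zero_of_ne_zero {X : ∀ x : M, TangentSpace 𝓘(ℝ, E) x}
    (hX : IsSmoothVectorField X) {m : M} (hm : X m ≠ 0) : ∀ᶠ p in 𝓝 m, X p ≠ 0 := by
  have h1 := ((contMDiffAt_coordRep_iff (mem_chart_source E m)).1 (hX m)).continuousAt
  have h2 : coordRep m X m ≠ 0 := by rwa [coordRep_self]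
  filter_upwards [h1.eventually_ne h2] with p hp h0
  exact hp (by rw [coordRep, h0]; exact map_zero _)

variable [FiniteDimensional ℝ E]

/-- The wedge of the normalized gradient and `X` satisfies the Jacobi identity. -/
lemma schouten_wedge_eq_zero [T2Space M] {X Y : ∀ x : M, TangentSpace 𝓘(ℝ, E) x}
    (hX : IsSmoothVectorField X) (hY : IsSmoothVectorField Y) {h : M → ℝ}
    (hh : IsFirstIntegral X h) {g : RiemMetric E M} (hg : IsTransversallyInvariant g X)
    (hYN : ∀ x ∈ supp X, Y x = normalizedGradient g h x) (x : M)
    (α β γ : TangentSpace 𝓘(ℝ, E) x →L[ℝ] ℝ) :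
    schouten (fun x => wedge (Y x) (X x)) (fun x => wedge (Y x) (X x)) x α β γ = 0 := by
  suffices h0 : schoutenHalf (fun x => wedge (Y x) (X x)) (fun x => wedge (Y x) (X x)) x α β γ = 0
    by rw [schouten, h0, add_zero]
  simp only [schoutenHalf, sharp_wedge]
  by_cases hx : X x = 0
  -- Each contraction `α(Y) X - α(X) Y` vanishes at a zero of `X`, so every derivative is taken in
  -- the zero direction.
  · simp [hx]
  have hdX := (((contMDiffAt_coordRep_iff (mem_chart_source E x)).1 (hX x)).mdifferentiableAt
    (by simp)).hasMFDerivAt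
  have hdY := (((contMDiffAt_coordRep_iff (mem_chart_source E x)).1 (hY x)).mdifferentiableAt
    (by simp)).hasMFDerivAt
  -- `X ≠ 0` is an open condition, so `Y` and the normalized gradient agree near `x` and share their
  -- derivative.
  have hdN := hdY.congr_of_eventuallyEq (f₁ := coordRep x (normalizedGradient g h)) (by
    filter_upwards [eventually_ne_zero_of_ne_zero hX hx] with p hp
    rw [coordRep, coordRep, hYN p (subset_closure hp)])
  have key := hg.bracket_tangent hX hh hdX hdN
  rw [← hYN x (subset_closure hx)] at key
  simp only [differential_wedge_chartExtend hdY hdX]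
  exact jacobi_of_bracket_tangent key α β γ

/-- A smooth vector field which is the normalized gradient on the support of `X`. -/
lemma exists_smooth_eq_normalizedGradient [T2Space M] [SecondCountableTopology M]
    (X : ∀ x : M, TangentSpace 𝓘(ℝ, E) x) {h : M → ℝ} (hh : ContMDiff 𝓘(ℝ, E) 𝓘(ℝ) ∞ h)
    (hreg : IsRegularOn E h (supp X)) (g : RiemMetric E M) :
    ∃ Y : ∀ x : M, TangentSpace 𝓘(ℝ, E) x, IsSmoothVectorField Y ∧
      ∀ x ∈ supp X, Y x = normalizedGradient g h x := by
  have : LocallyCompactSpace M := Manifold.locallyCompact_of_finiteDimensional 𝓘(ℝ, E)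
  -- The constraint is a single point over `supp X` and the whole fibre elsewhere; both are convex,
  -- so local solutions can be averaged.
  have hconv : ∀ x : M, Convex ℝ {v : TangentSpace 𝓘(ℝ, E) x |
      x ∈ supp X → v = normalizedGradient g h x} := fun x => by
    by_cases hx : x ∈ supp X
    · simp only [hx, true_imp_iff]
      exact convex_singleton _
    · simp only [hx, false_imp_iff]
      exact convex_univ
  obtain ⟨s, hs⟩ := exists_contMDiffSection_forall_mem_convex_of_local (n := ⊤) (F_fiber := E)
    𝓘(ℝ, E) (fun x : M => TangentSpace 𝓘(ℝ, E) x) _ hconv (by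
      intro x
      by_cases hx : x ∈ supp X
      · exact ⟨_, eventually_differential_ne_zero hh (hreg x hx), normalizedGradient g h,
          fun p hp => (contMDiffAt_normalizedGradient g hh hp).contMDiffWithinAt, fun p _ _ => rfl⟩
      · exact ⟨_, isClosed_closure.isOpen_compl.mem_nhds hx, fun _ => 0,
          (Bundle.contMDiff_zeroSection ℝ _).contMDiffOn, fun p hp hp' => (hp hp').elim⟩)
  exact ⟨s, s.contMDiff, hs⟩

end

end Hamiltonization

end

open Hamiltonization in
theorem theorem5p1
    {E : Type*} [NormedAddCommGroup E] [NormedSpace ℝ E] [FiniteDimensional ℝ E]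
    {M : Type*} [TopologicalSpace M] [T2Space M] [SecondCountableTopology M]
    [ChartedSpace E M] [IsManifold 𝓘(ℝ, E) ∞ M]
    (X : ∀ x : M, TangentSpace 𝓘(ℝ, E) x) (hX : IsSmoothVectorField X)
    (h : M → ℝ) (hh : IsFirstIntegral X h) (hreg : IsRegularOn E h (supp X))
    (g : RiemMetric E M) (hg : IsTransversallyInvariant g X) :
    IsHamiltonizable X ∧
    ∃ Y : ∀ x : M, TangentSpace 𝓘(ℝ, E) x,
      IsSmoothVectorField Y ∧
      (∀ x ∈ supp X, Y x = normalizedGradient g h x) ∧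
      IsPoisson (fun x => wedge (Y x) (X x)) ∧
      IsHamiltonianFor (fun x => wedge (Y x) (X x)) h X := by
  obtain ⟨Y, hY, hYN⟩ := exists_smooth_eq_normalizedGradient X hh.1 hreg g
  have hP : IsPoisson (fun x => wedge (Y x) (X x)) :=
    ⟨fun x α => by rw [wedge_apply]; ring, contMDiff_wedge hY hX,
      schouten_wedge_eq_zero hX hY hh hg hYN⟩
  have hH : IsHamiltonianFor (fun x => wedge (Y x) (X x)) h X := fun x => by
    rw [sharp_wedge, hh.2 x, zero_smul, sub_zero]
    by_cases hx : X x = 0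
    -- At a zero of `X` the value of `dh(Y)` is irrelevant.
    · rw [hx, smul_zero]
    · have hxs : x ∈ supp X := subset_closure hx
      rw [hYN x hxs, differential_normalizedGradient g (hreg x hxs), one_smul]
  exact ⟨⟨_, h, hP, hh.1, hH⟩, Y, hY, hYN, hP, hH⟩
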